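/- Let $\mathbb D=\{z\in\mathbb C:|z|<1\}$, let $H$ be a nonzero separable complex Hilbert space and let $\alpha>-1$. Put $dA_\alpha(z)=(\alpha+1)(1-|z|^2)^\alpha\,dA(z)$, where $dA=\pi^{-1}dx\,dy$ is the normalized area measure on $\mathbb D$. Let $\mathcal A^2_\alpha(H)$ be the space of analytic functions $f:\mathbb D\to H$ (that is, $f(z)=\sum_{n\ge 0}y_nz^n$ on $\mathbb D$ with $y_n\in H$) such that $$\|f\|^2=\int_{\mathbb D}\|f(z)\|^2\,dA_\alpha(z)<\infty .$$ Let $\Phi:\mathbb D\to\mathbb D$ be analytic. Then the composition operator $C_\Phi f=f\circ\Phi$ is a bounded linear operator on $\mathcal A^2_\alpha(H)$, and its operator norm satisfies $$\|C_\Phi\|\;\ge\;\frac{1}{\sqrt{(1-|\Phi(0)|^2)^{2+\alpha}}}.$$ -/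

import Mathlib

open MeasureTheory

noncomputable section

/-- The open unit disk `{z : ℂ | ‖z‖ < 1}`, with the topology and the measurable structure
inherited from `ℂ`. -/
abbrev OpenUnitDisk : Type := ↥(Metric.ball (0 : ℂ) 1)

namespace OpenUnitDisk

/-- The centre of the disk. -/
def origin : OpenUnitDisk := ⟨0, Metric.mem_ball_self one_pos⟩

/-- A function `f` on the open unit disk with values in a complex normed space is analytic if
`f z = ∑ yₙ zⁿ` on the whole disk, for some coefficients `yₙ`. -/
def IsAnalytic {X : Type*} [NormedAddCommGroup X] [NormedSpace ℂ X] (f : OpenUnitDisk → X) :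
    Prop :=
  ∃ y : ℕ → X, ∀ z : OpenUnitDisk, HasSum (fun n : ℕ => (z : ℂ) ^ n • y n) (f z)

/-- The normalized area measure `dA = π⁻¹ dx dy` on the disk. -/
def area : Measure OpenUnitDisk :=
  ENNReal.ofReal Real.pi⁻¹ • (volume : Measure ℂ).comap ((↑) : OpenUnitDisk → ℂ)

/-- The weighted area measure `dA_α(z) = (α + 1) (1 - |z|²)^α dA(z)` on the disk. -/
def weightedArea (α : ℝ) : Measure OpenUnitDisk :=
  area.withDensity fun z => ENNReal.ofReal ((α + 1) * (1 - ‖(z : ℂ)‖ ^ 2) ^ α)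

theorem IsAnalytic.continuous {X : Type*} [NormedAddCommGroup X] [NormedSpace ℂ X]
    [CompleteSpace X] {f : OpenUnitDisk → X} (hf : IsAnalytic f) : Continuous f := by
  obtain ⟨y, hy⟩ := hf
  have key : ∀ r : NNReal, r < 1 → Summable fun n : ℕ => ‖y n‖ * (r : ℝ) ^ n := by
    intro r hr
    obtain ⟨s, hrs, hs⟩ := exists_between hr
    have hsm : ((s : ℝ) : ℂ) ∈ Metric.ball (0 : ℂ) 1 := by
      simpa using hs
    have hs0 : (0 : ℝ) < s := lt_of_le_of_lt r.2 (by exact_mod_cast hrs)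
    have ht := (hy ⟨_, hsm⟩).summable.tendsto_atTop_zero
    obtain ⟨C, hC⟩ := ht.norm.bddAbove_range
    have hC' : ∀ n, ‖y n‖ * (s : ℝ) ^ n ≤ C := by
      intro n
      have := hC (Set.mem_range_self n)
      simpa [norm_smul, mul_comm] using this
    have hq : (r : ℝ) / s < 1 := (div_lt_one hs0).2 (by exact_mod_cast hrs)
    refine Summable.of_nonneg_of_le (fun n => by positivity) (fun n => ?_)
      ((summable_geometric_of_lt_one (by positivity) hq).mul_left C)
    calc ‖y n‖ * (r : ℝ) ^ n = (‖y n‖ * (s : ℝ) ^ n) * (r / s) ^ n := by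
          rw [div_pow]; field_simp
      _ ≤ C * (r / s) ^ n := by gcongr; exact hC' n
  rw [continuous_iff_continuousAt]
  intro z
  have hz : ‖(z : ℂ)‖ < 1 := mem_ball_zero_iff.1 z.2
  obtain ⟨r, hzr, hr⟩ := exists_between hz
  have hr0 : 0 ≤ r := (norm_nonneg _).trans hzr.le
  lift r to NNReal using hr0
  have hc : ContinuousOn (fun w : OpenUnitDisk => ∑' n : ℕ, (w : ℂ) ^ n • y n)
      {w | ‖(w : ℂ)‖ < r} := by
    refine continuousOn_tsum (fun n => by fun_prop) (key r (by exact_mod_cast hr)) ?_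
    intro n w hw
    rw [norm_smul, norm_pow, mul_comm]
    gcongr
    exact le_of_lt hw
  have hopen : IsOpen {w : OpenUnitDisk | ‖(w : ℂ)‖ < r} :=
    isOpen_lt (by fun_prop) continuous_const
  have hfe : f = fun w : OpenUnitDisk => ∑' n : ℕ, (w : ℂ) ^ n • y n :=
    funext fun w => (hy w).tsum_eq.symm
  rw [hfe]
  exact hc.continuousAt (hopen.mem_nhds hzr)

theorem isOpenPosMeasure_weightedArea {α : ℝ} (hα : -1 < α) :
    (weightedArea α).IsOpenPosMeasure := by
  have h1 : ((volume : Measure ℂ).comap ((↑) : OpenUnitDisk → ℂ)).IsOpenPosMeasure :=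
    Measure.IsOpenPosMeasure.comap (μ := (volume : Measure ℂ))
      Metric.isOpen_ball.isOpenEmbedding_subtypeVal
  have h2 : area.IsOpenPosMeasure := by
    refine ⟨fun U hU hne => ?_⟩
    have := hU.measure_ne_zero ((volume : Measure ℂ).comap ((↑) : OpenUnitDisk → ℂ)) hne
    simp [area, this, Real.pi_pos]
  refine Measure.AbsolutelyContinuous.isOpenPosMeasure (μ := area) ?_
  refine withDensity_absolutelyContinuous' (by fun_prop) (Filter.Eventually.of_forall fun z => ?_)
  have hz : ‖(z : ℂ)‖ < 1 := mem_ball_zero_iff.1 z.2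
  have : 0 < 1 - ‖(z : ℂ)‖ ^ 2 := by nlinarith [norm_nonneg (z : ℂ)]
  have h3 : 0 < (α + 1) * (1 - ‖(z : ℂ)‖ ^ 2) ^ α :=
    mul_pos (by linarith) (Real.rpow_pos_of_pos this α)
  simpa using h3

end OpenUnitDisk

open OpenUnitDisk

/-- The analytic functions `f : 𝔻 → H` that are square integrable with respect to `dA_α`, as a
linear subspace of all functions `𝔻 → H`. -/
def bergmanSubmodule (α : ℝ) (H : Type*) [NormedAddCommGroup H] [NormedSpace ℂ H] :
    Submodule ℂ (OpenUnitDisk → H) where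
  carrier := {f | IsAnalytic f ∧ MemLp f 2 (weightedArea α)}
  add_mem' := by
    rintro f g ⟨⟨y, hy⟩, hf⟩ ⟨⟨s, hs⟩, hg⟩
    refine ⟨⟨y + s, fun z => ?_⟩, hf.add hg⟩
    simpa using (hy z).add (hs z)
  zero_mem' := ⟨⟨0, fun z => by simp⟩, MemLp.zero⟩
  smul_mem' := by
    rintro c f ⟨⟨y, hy⟩, hf⟩
    refine ⟨⟨c • y, fun z => ?_⟩, hf.const_smul c⟩
    simpa [smul_comm c] using (hy z).const_smul c

/-- The weighted Bergman space `𝒜²_α(H)`, `α > -1`, of functions on the disk with values in `H`.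
(A separate type, so that its topology is that of the norm below and not that of pointwise
convergence.) -/
def BergmanSpace (α : ℝ) (_ : -1 < α) (H : Type*) [NormedAddCommGroup H] [NormedSpace ℂ H] :
    Type _ :=
  ↥(bergmanSubmodule α H)

namespace BergmanSpace

variable {α : ℝ} {hα : -1 < α} {H : Type*} [NormedAddCommGroup H] [NormedSpace ℂ H]

instance instAddCommGroup : AddCommGroup (BergmanSpace α hα H) :=
  inferInstanceAs (AddCommGroup ↥(bergmanSubmodule α H))

instance instModule : Module ℂ (BergmanSpace α hα H) :=
  inferInstanceAs (Module ℂ ↥(bergmanSubmodule α H))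

instance instFunLike : FunLike (BergmanSpace α hα H) OpenUnitDisk H where
  coe f := f.1
  coe_injective _ _ h := Subtype.ext h

theorem isAnalytic (f : BergmanSpace α hα H) : IsAnalytic (f : OpenUnitDisk → H) := f.2.1

theorem memLp (f : BergmanSpace α hα H) : MemLp (f : OpenUnitDisk → H) 2 (weightedArea α) := f.2.2

/-- The inclusion of `𝒜²_α(H)` into `L²(dA_α; H)`. -/
def toL2 : BergmanSpace α hα H →ₗ[ℂ] Lp H 2 (weightedArea α) where
  toFun f := f.memLp.toLp f
  map_add' _ _ := rfl
  map_smul' _ _ := rfl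

theorem toL2_injective [CompleteSpace H] :
    Function.Injective (toL2 : BergmanSpace α hα H →ₗ[ℂ] Lp H 2 (weightedArea α)) := by
  intro f g hfg
  have := isOpenPosMeasure_weightedArea hα
  have h := (MemLp.toLp_eq_toLp_iff f.memLp g.memLp).1 hfg
  exact DFunLike.coe_injective
    ((Continuous.ae_eq_iff_eq _ f.isAnalytic.continuous g.isAnalytic.continuous).1 h)

/-- The norm of `𝒜²_α(H)` is the norm of `L²(dA_α; H)`. -/
instance instNormedAddCommGroup [CompleteSpace H] : NormedAddCommGroup (BergmanSpace α hα H) :=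
  NormedAddCommGroup.induced _ _ (toL2 : BergmanSpace α hα H →ₗ[ℂ] Lp H 2 (weightedArea α))
    toL2_injective

instance instNormedSpace [CompleteSpace H] : NormedSpace ℂ (BergmanSpace α hα H) :=
  NormedSpace.induced ℂ _ _ (toL2 : BergmanSpace α hα H →ₗ[ℂ] Lp H 2 (weightedArea α))

theorem norm_sq_eq [CompleteSpace H] (f : BergmanSpace α hα H) :
    ‖f‖ ^ 2 = ∫ z, ‖f z‖ ^ 2 ∂(weightedArea α) := by
  have h1 : ‖f‖ = (eLpNorm (f : OpenUnitDisk → H) 2 (weightedArea α)).toReal :=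
    Lp.norm_toLp _ f.memLp
  rw [h1, f.memLp.eLpNorm_eq_integral_rpow_norm (by norm_num) (by norm_num),
    ENNReal.toReal_ofReal (by positivity), ← Real.rpow_natCast, ← Real.rpow_mul (by positivity)]
  simp

end BergmanSpace

end

/-! Put $a=\Phi(0)$ and let $\varphi_a$ be the involutive disk automorphism exchanging $0$ and $a$.

Boundedness: $f\circ\Phi=(f\circ\varphi_a)\circ(\varphi_a\circ\Phi)$, and the inner map fixes $0$.
Littlewood subordination (`circleAverage_norm_sq_comp_le`) makes composition with it a contraction
on every circle mean, hence, in polar coordinates, for the weighted area integral. Composition with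
$\varphi_a$ is handled by a change of variables whose density $(|\varphi_a'|)^{\alpha+2}$ is bounded
on the disk.

Lower bound: test on $k_a h$, with $h\ne0$ and $k_a(z)=(1-\bar a z)^{-(\alpha+2)}$. If $m$ is the
total mass of $dA_\alpha$ and $p=(1-|a|^2)^{\alpha+2}$, the same change of variables gives
$\|k_ah\|^2=p^{-1}m\|h\|^2$ (`lintegral_enorm_sq_bergmanKernel`). The image takes the value
$k_a(a)h$, of norm $p^{-1}\|h\|$, at $0$, so its squared norm is at least $p^{-2}\|h\|^2m$
(`enorm_sq_apply_zero_mul_le`). The quotient is $p^{-1}\le\|C_\Phi\|^2$. -/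

open OpenUnitDisk

/-! ### Power series on the disk and holomorphic functions -/

section Analytic

variable {X : Type*} [NormedAddCommGroup X] [NormedSpace ℂ X]

theorem OpenUnitDisk.norm_lt_one (z : OpenUnitDisk) : ‖(z : ℂ)‖ < 1 := mem_ball_zero_iff.1 z.2

/-- A power series with convergent values on the disk converges absolutely there. -/
theorem summable_norm_mul_pow_of_hasSum {y : ℕ → X} {F : ℂ → X}
    (hy : ∀ z : ℂ, ‖z‖ < 1 → HasSum (fun n : ℕ => z ^ n • y n) (F z)) {r : ℝ} (hr0 : 0 ≤ r)
    (hr : r < 1) : Summable fun n : ℕ => r ^ n * ‖y n‖ := by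
  -- Convergence at $s\in(r,1)$ bounds the terms there, so those at $r$ are dominated by a geometric
  -- series of ratio $r/s$.
  obtain ⟨s, hrs, hs⟩ := exists_between hr
  have hs0 : 0 < s := hr0.trans_lt hrs
  have ht := (hy (s : ℂ) (by simpa [abs_of_pos hs0] using hs)).summable.tendsto_atTop_zero
  obtain ⟨C, hC⟩ := ht.norm.bddAbove_range
  have hC' : ∀ n, s ^ n * ‖y n‖ ≤ C := by
    intro n
    have := hC (Set.mem_range_self n)
    simpa [norm_smul, abs_of_pos hs0] using this
  have hq : r / s < 1 := (div_lt_one hs0).2 hrs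
  refine Summable.of_nonneg_of_le (fun n => by positivity) (fun n => ?_)
    ((summable_geometric_of_lt_one (by positivity) hq).mul_left C)
  calc r ^ n * ‖y n‖ = (s ^ n * ‖y n‖) * (r / s) ^ n := by
        rw [div_pow]; field_simp
    _ ≤ C * (r / s) ^ n := by gcongr; exact hC' n

variable [CompleteSpace X]

/-- The sum of a power series converging on the disk is holomorphic there. -/
theorem differentiableOn_of_hasSum_pow_smul {y : ℕ → X} {F : ℂ → X}
    (hy : ∀ z : ℂ, ‖z‖ < 1 → HasSum (fun n : ℕ => z ^ n • y n) (F z)) :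
    DifferentiableOn ℂ F (Metric.ball 0 1) := by
  intro z hz
  have hz' : ‖z‖ < 1 := mem_ball_zero_iff.1 hz
  obtain ⟨r, hzr, hr⟩ := exists_between hz'
  have hd : DifferentiableOn ℂ (fun w : ℂ => ∑' n : ℕ, w ^ n • y n) (Metric.ball 0 r) := by
    refine Complex.differentiableOn_tsum_of_summable_norm
      (summable_norm_mul_pow_of_hasSum hy ((norm_nonneg z).trans hzr.le) hr)
      (fun n => by fun_prop) Metric.isOpen_ball ?_
    intro n w hw
    rw [norm_smul, norm_pow]
    gcongr
    exact (mem_ball_zero_iff.1 hw).le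
  have hmem : Metric.ball (0 : ℂ) r ∈ nhds z :=
    Metric.isOpen_ball.mem_nhds (mem_ball_zero_iff.2 hzr)
  refine ((hd.differentiableAt hmem).congr_of_eventuallyEq ?_).differentiableWithinAt
  filter_upwards [hmem] with w hw
  exact (hy w ((mem_ball_zero_iff.1 hw).trans hr)).tsum_eq.symm

theorem exists_hasSum_pow_smul_of_differentiableOn {F : ℂ → X}
    (hF : DifferentiableOn ℂ F (Metric.ball 0 1)) :
    ∃ y : ℕ → X, ∀ z : ℂ, ‖z‖ < 1 → HasSum (fun n : ℕ => z ^ n • y n) (F z) := by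
  refine ⟨fun n => (n.factorial : ℂ)⁻¹ • iteratedDeriv n F 0, fun z hz => ?_⟩
  have := Complex.hasSum_taylorSeries_on_ball hF (mem_ball_zero_iff.2 hz)
  rw [sub_zero] at this
  convert this using 2 with n
  exact smul_comm _ _ _

theorem OpenUnitDisk.isAnalytic_of_differentiableOn {F : ℂ → X}
    (hF : DifferentiableOn ℂ F (Metric.ball 0 1)) :
    IsAnalytic fun z : OpenUnitDisk => F z := by
  obtain ⟨y, hy⟩ := exists_hasSum_pow_smul_of_differentiableOn hF
  exact ⟨y, fun z => hy z z.norm_lt_one⟩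

/-- Passage to total functions on `ℂ`, where complex analysis applies; the values off the disk play
no role. -/
theorem OpenUnitDisk.IsAnalytic.exists_differentiableOn {f : OpenUnitDisk → X}
    (hf : IsAnalytic f) :
    ∃ F : ℂ → X, DifferentiableOn ℂ F (Metric.ball 0 1) ∧ ∀ z : OpenUnitDisk, F z = f z := by
  obtain ⟨y, hy⟩ := hf
  have hy' : ∀ z : ℂ, ‖z‖ < 1 → HasSum (fun n : ℕ => z ^ n • y n) (∑' n : ℕ, z ^ n • y n) :=
    fun z hz => (hy ⟨z, mem_ball_zero_iff.2 hz⟩).summable.hasSum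
  exact ⟨_, differentiableOn_of_hasSum_pow_smul hy', fun z => (hy z).tsum_eq⟩

end Analytic

/-! ### Quadratic circle means and subordination -/

section CircleMeans

variable {X : Type*} [NormedAddCommGroup X] [InnerProductSpace ℂ X]

open Real Metric in
theorem circleIntegrable_of_continuousOn_ball {E : Type*} [NormedAddCommGroup E]
    {F : ℂ → E} (hF : ContinuousOn F (ball 0 1)) {r : ℝ} (hr0 : 0 < r)
    (hr : r < 1) : CircleIntegrable F 0 r := by
  refine ContinuousOn.circleIntegrable hr0.le (hF.mono ?_)
  intro z hz
  simp only [mem_sphere_zero_iff_norm] at hz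
  simp [hz, hr]

open Real Metric in
theorem circleAverage_of_differentiableOn_ball {E : Type*} [NormedAddCommGroup E]
    [NormedSpace ℂ E] [CompleteSpace E]
    {F : ℂ → E} (hF : DifferentiableOn ℂ F (ball 0 1)) {r : ℝ} (hr0 : 0 < r)
    (hr : r < 1) : circleAverage F 0 r = F 0 := by
  refine DiffContOnCl.circleAverage ?_
  rw [abs_of_pos hr0]
  exact hF.diffContOnCl_ball (closedBall_subset_ball hr)

open Real Metric in
/-- Pythagoras on a circle: a holomorphic function vanishing at the centre is orthogonal to the
constants. -/
theorem circleAverage_norm_sq_const_add {k : ℂ → X}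
    (hk : DifferentiableOn ℂ k (ball 0 1)) (hk0 : k 0 = 0) (c : X) {r : ℝ} (hr0 : 0 < r)
    (hr : r < 1) :
    circleAverage (fun z => ‖c + k z‖ ^ 2) 0 r = ‖c‖ ^ 2 + circleAverage (fun z => ‖k z‖ ^ 2) 0 r := by
  -- The inner product is linear in its second argument, so the cross term is twice the real part of
  -- a holomorphic function vanishing at $0$; the mean value property kills it.
  have hi : DifferentiableOn ℂ (fun z => (innerSL ℂ c) (k z)) (ball 0 1) := by fun_prop
  have hav : circleAverage (fun z => (innerSL ℂ c) (k z)) 0 r = 0 := by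
    rw [circleAverage_of_differentiableOn_ball hi hr0 hr, hk0, map_zero]
  have hci := circleIntegrable_of_continuousOn_ball hi.continuousOn hr0 hr
  have hre : circleAverage (fun z => Complex.reCLM ((innerSL ℂ c) (k z))) 0 r = 0 := by
    have := ContinuousLinearMap.circleAverage_comp_comm Complex.reCLM hci
    rw [hav, map_zero] at this
    exact this
  have hcont : ContinuousOn (fun z => ‖k z‖ ^ 2) (ball 0 1) := hk.continuousOn.norm.pow 2
  have hrec : ContinuousOn (fun z => Complex.reCLM ((innerSL ℂ c) (k z))) (ball 0 1) :=
    Complex.reCLM.continuous.comp_continuousOn hi.continuousOn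
  have heq : (fun z => ‖c + k z‖ ^ 2) = (fun _ => ‖c‖ ^ 2) +
      ((fun z => (2 : ℝ) • Complex.reCLM ((innerSL ℂ c) (k z))) + fun z => ‖k z‖ ^ 2) := by
    funext z
    simp only [Pi.add_apply]
    rw [@norm_add_sq ℂ]
    simp
    ring
  rw [heq, circleAverage_add, circleAverage_add, circleAverage_const]
  · rw [circleAverage_fun_smul, hre]
    simp
  · exact circleIntegrable_of_continuousOn_ball (hrec.const_smul (2 : ℝ)) hr0 hr
  · exact circleIntegrable_of_continuousOn_ball hcont hr0 hr
  · exact circleIntegrable_const _ _ _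
  · exact circleIntegrable_of_continuousOn_ball ((hrec.const_smul (2 : ℝ)).add hcont) hr0 hr

open Real Metric Filter Topology in
/-- **Littlewood's subordination principle** for the quadratic means on circles. -/
theorem circleAverage_norm_sq_comp_le [CompleteSpace X] {F : ℂ → X} (hF : DifferentiableOn ℂ F (ball 0 1))
    {ψ : ℂ → ℂ} (hψ : DifferentiableOn ℂ ψ (ball 0 1)) (hmaps : Set.MapsTo ψ (ball 0 1) (ball 0 1))
    (hψ0 : ψ 0 = 0) {r : ℝ} (hr0 : 0 < r) (hr : r < 1) :
    circleAverage (fun z => ‖F (ψ z)‖ ^ 2) 0 r ≤ circleAverage (fun z => ‖F z‖ ^ 2) 0 r := by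
  obtain ⟨y, hy⟩ := exists_hasSum_pow_smul_of_differentiableOn hF
  -- Schwarz lemma: the only way in which `ψ 0 = 0` limits the size of `ψ`.
  have hsch : ∀ z, ‖z‖ < 1 → ‖ψ z‖ ≤ ‖z‖ := fun z hz =>
    Complex.norm_le_norm_of_mapsTo_ball hψ (hmaps.mono_right ball_subset_closedBall) hψ0 hz
  have hsub : sphere (0 : ℂ) r ⊆ ball 0 1 := fun z hz => by
    simp only [mem_sphere_zero_iff_norm] at hz
    simp [hz, hr]
  -- the iterated backward shifts of `F`
  set G : ℕ → ℂ → X := fun n z => ∑' k : ℕ, z ^ k • y (k + n) with hG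
  have hsum : ∀ (n : ℕ) (z : ℂ), ‖z‖ < 1 → Summable fun k : ℕ => ‖z ^ k • y (k + n)‖ := by
    intro n z hz
    obtain ⟨s, hzs, hs⟩ := exists_between hz
    have hs0 : 0 < s := (norm_nonneg z).trans_lt hzs
    have h1 := (summable_nat_add_iff n).2 (summable_norm_mul_pow_of_hasSum hy hs0.le hs)
    refine Summable.of_nonneg_of_le (fun k => norm_nonneg _) (fun k => ?_)
      (h1.mul_left (s ^ n)⁻¹)
    rw [norm_smul, norm_pow, pow_add]
    calc ‖z‖ ^ k * ‖y (k + n)‖ ≤ s ^ k * ‖y (k + n)‖ := by gcongr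
      _ = _ := by field_simp
  have hGs : ∀ (n : ℕ) (z : ℂ), ‖z‖ < 1 → HasSum (fun k : ℕ => z ^ k • y (k + n)) (G n z) :=
    fun n z hz => (hsum n z hz).of_norm.hasSum
  have hGd : ∀ n, DifferentiableOn ℂ (G n) (ball 0 1) := fun n =>
    differentiableOn_of_hasSum_pow_smul (hGs n)
  have hrec : ∀ (n : ℕ) (z : ℂ), ‖z‖ < 1 → G n z = y n + z • G (n + 1) z := by
    intro n z hz
    have h1 := ((hGs (n + 1) z hz).const_smul z)
    refine (hGs n z hz).unique ?_
    rw [← hasSum_nat_add_iff' 1]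
    simp only [Finset.range_one, Finset.sum_singleton, pow_zero, zero_add, one_smul,
      add_sub_cancel_left]
    convert h1 using 2 with k
    rw [smul_smul, pow_succ', add_assoc, add_comm 1 n]
  have hψc := hψ.continuousOn
  have hGψd : ∀ n, DifferentiableOn ℂ (fun z => G n (ψ z)) (ball 0 1) := fun n =>
    (hGd n).comp hψ hmaps
  -- Pythagoras for $G_n\circ\chi=y_n+\chi\cdot(G_{n+1}\circ\chi)$. With $\chi=\psi$ the factor
  -- $|\chi|^2$ is at most $r^2$ on the circle; with $\chi=\mathrm{id}$ it equals $r^2$.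
  have hstep : ∀ n (χ : ℂ → ℂ), DifferentiableOn ℂ χ (ball 0 1) → Set.MapsTo χ (ball 0 1) (ball 0 1)
      → χ 0 = 0 → circleAverage (fun z => ‖G n (χ z)‖ ^ 2) 0 r =
        ‖y n‖ ^ 2 + circleAverage (fun z => ‖χ z‖ ^ 2 * ‖G (n + 1) (χ z)‖ ^ 2) 0 r := by
    intro n χ hχ hm h0
    have hd : DifferentiableOn ℂ (fun z => χ z • G (n + 1) (χ z)) (ball 0 1) :=
      hχ.smul ((hGd (n + 1)).comp hχ hm)
    have := circleAverage_norm_sq_const_add hd (by simp [h0]) (y n) hr0 hr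
    simp only [norm_smul, mul_pow] at this
    rw [← this]
    refine circleAverage_congr_sphere ?_
    intro z hz
    rw [abs_of_pos hr0] at hz
    simp only
    rw [hrec n (χ z) (mem_ball_zero_iff.1 (hm (hsub hz)))]
  have hint : ∀ n, CircleIntegrable (fun z => ‖G n (ψ z)‖ ^ 2) 0 r := fun n =>
    circleIntegrable_of_continuousOn_ball ((hGψd n).continuousOn.norm.pow 2) hr0 hr
  have hψstep : ∀ n, circleAverage (fun z => ‖G n (ψ z)‖ ^ 2) 0 r ≤
        ‖y n‖ ^ 2 + r ^ 2 * circleAverage (fun z => ‖G (n + 1) (ψ z)‖ ^ 2) 0 r := by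
    intro n
    rw [hstep n ψ hψ hmaps hψ0, ← smul_eq_mul (r ^ 2), ← circleAverage_fun_smul]
    refine add_le_add le_rfl (circleAverage_mono ?_ ((hint (n + 1)).const_smul) ?_)
    · exact circleIntegrable_of_continuousOn_ball ((hψc.norm.pow 2).mul
        ((hGψd (n + 1)).continuousOn.norm.pow 2)) hr0 hr
    · intro z hz
      rw [abs_of_pos hr0] at hz
      have h1 := hsch z (mem_ball_zero_iff.1 (hsub hz))
      rw [mem_sphere_zero_iff_norm.1 hz] at h1
      simp only [smul_eq_mul]
      gcongr
  have hidstep : ∀ n, circleAverage (fun z => ‖G n z‖ ^ 2) 0 r =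
        ‖y n‖ ^ 2 + r ^ 2 * circleAverage (fun z => ‖G (n + 1) z‖ ^ 2) 0 r := by
    intro n
    rw [hstep n (fun z => z) differentiableOn_id (Set.mapsTo_id _) rfl, ← smul_eq_mul (r ^ 2),
      ← circleAverage_fun_smul]
    congr 1
    refine circleAverage_congr_sphere ?_
    intro z hz
    rw [abs_of_pos hr0, mem_sphere_zero_iff_norm] at hz
    simp [hz]
  have hiter : ∀ n, circleAverage (fun z => ‖G 0 (ψ z)‖ ^ 2) 0 r ≤
      circleAverage (fun z => ‖G 0 z‖ ^ 2) 0 r +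
        r ^ (2 * n) * circleAverage (fun z => ‖G n (ψ z)‖ ^ 2) 0 r := by
    -- Subtracting the equality for the identity from the inequality for `ψ` cancels $\|y_n\|^2$ and
    -- leaves a factor $r^2$ per step.
    have : ∀ n, circleAverage (fun z => ‖G 0 (ψ z)‖ ^ 2) 0 r -
      circleAverage (fun z => ‖G 0 z‖ ^ 2) 0 r ≤
        r ^ (2 * n) * (circleAverage (fun z => ‖G n (ψ z)‖ ^ 2) 0 r -
          circleAverage (fun z => ‖G n z‖ ^ 2) 0 r) := by
      intro n
      induction n with
      | zero => simp
      | succ n ih =>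
        refine ih.trans ?_
        rw [mul_add, pow_add, mul_assoc]
        gcongr
        rw [mul_one]
        linarith [hψstep n, hidstep n]
    intro n
    have h0 : 0 ≤ circleAverage (fun z => ‖G n z‖ ^ 2) 0 r :=
      circleAverage_nonneg_of_nonneg (fun z _ => by positivity)
    have h1 : 0 ≤ r ^ (2 * n) * circleAverage (fun z => ‖G n z‖ ^ 2) 0 r := by positivity
    linarith [this n]
  -- the remainder tends to zero
  set T : ℕ → ℝ := fun n => ∑' k : ℕ, r ^ (k + n) * ‖y (k + n)‖ with hT
  have hT0 : Tendsto T atTop (𝓝 0) := tendsto_sum_nat_add fun k => r ^ k * ‖y k‖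
  -- Since $|\psi|\le r$ on the circle, $r^n\|G_n\circ\psi\|$ is at most the tail of the convergent
  -- series $\sum r^k\|y_k\|$.
  have hbound : ∀ n, r ^ (2 * n) * circleAverage (fun z => ‖G n (ψ z)‖ ^ 2) 0 r ≤ T n ^ 2 := by
    intro n
    rw [← smul_eq_mul, ← circleAverage_fun_smul]
    refine circleAverage_mono_on_of_le_circle ((hint n).const_smul) ?_
    intro z hz
    rw [abs_of_pos hr0] at hz
    have h1 := hsch z (mem_ball_zero_iff.1 (hsub hz))
    rw [mem_sphere_zero_iff_norm.1 hz] at h1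
    have h2 : r ^ n * ‖G n (ψ z)‖ ≤ T n := by
      have hs := (summable_nat_add_iff n).2 (summable_norm_mul_pow_of_hasSum hy hr0.le hr)
      have hn := hsum n (ψ z) (h1.trans_lt hr)
      calc r ^ n * ‖G n (ψ z)‖ ≤ r ^ n * ∑' k : ℕ, ‖ψ z ^ k • y (k + n)‖ := by
            gcongr; exact norm_tsum_le_tsum_norm hn
        _ = ∑' k : ℕ, r ^ n * ‖ψ z ^ k • y (k + n)‖ := tsum_mul_left.symm
        _ ≤ T n := by
            refine (hn.mul_left _).tsum_le_tsum (fun k => ?_) hs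
            rw [norm_smul, norm_pow, pow_add, ← mul_assoc, mul_comm (r ^ k)]
            gcongr
    simp only [smul_eq_mul]
    calc r ^ (2 * n) * ‖G n (ψ z)‖ ^ 2 = (r ^ n * ‖G n (ψ z)‖) ^ 2 := by ring
      _ ≤ T n ^ 2 := by gcongr
  have hlim : Tendsto (fun n => circleAverage (fun z => ‖G 0 z‖ ^ 2) 0 r + T n ^ 2) atTop
      (𝓝 (circleAverage (fun z => ‖G 0 z‖ ^ 2) 0 r)) := by
    simpa using (hT0.pow 2).const_add (circleAverage (fun z => ‖G 0 z‖ ^ 2) 0 r)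
  have hfin := ge_of_tendsto' hlim fun n => (hiter n).trans (by gcongr; exact hbound n)
  have hG0 : ∀ z, ‖z‖ < 1 → G 0 z = F z := fun z hz => (hy z hz).tsum_eq
  have e1 : circleAverage (fun z => ‖G 0 z‖ ^ 2) 0 r = circleAverage (fun z => ‖F z‖ ^ 2) 0 r := by
    refine circleAverage_congr_sphere fun z hz => ?_
    rw [abs_of_pos hr0] at hz
    rw [hG0 z (mem_ball_zero_iff.1 (hsub hz))]
  have e2 : circleAverage (fun z => ‖G 0 (ψ z)‖ ^ 2) 0 r =
      circleAverage (fun z => ‖F (ψ z)‖ ^ 2) 0 r := by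
    refine circleAverage_congr_sphere fun z hz => ?_
    rw [abs_of_pos hr0] at hz
    rw [hG0 _ (mem_ball_zero_iff.1 (hmaps (hsub hz)))]
  rwa [e1, e2] at hfin

end CircleMeans

/-! ### The weighted area integral in polar coordinates -/

section PolarCoordinates

open Real Metric Set
open scoped ENNReal

theorem lintegral_weightedArea (α : ℝ) (G : ℂ → ℝ≥0∞) :
    ∫⁻ z : OpenUnitDisk, G z ∂weightedArea α =
      ENNReal.ofReal π⁻¹ *
        ∫⁻ z in ball (0 : ℂ) 1, ENNReal.ofReal ((α + 1) * (1 - ‖z‖ ^ 2) ^ α) * G z := by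
  rw [weightedArea, lintegral_withDensity_eq_lintegral_mul_non_measurable _ (by fun_prop)
    (Filter.Eventually.of_forall fun z => ENNReal.ofReal_lt_top), area, lintegral_smul_measure,
    smul_eq_mul]
  congr 1
  exact lintegral_subtype_comap measurableSet_ball
    (fun z : ℂ => ENNReal.ofReal ((α + 1) * (1 - ‖z‖ ^ 2) ^ α) * G z)

theorem lintegral_weightedArea_polar (α : ℝ) {G : ℂ → ℝ≥0∞} (hG : Measurable G) :
    ∫⁻ z : OpenUnitDisk, G z ∂weightedArea α =
      ENNReal.ofReal π⁻¹ * ∫⁻ r in Ioo (0 : ℝ) 1,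
        ENNReal.ofReal r * ENNReal.ofReal ((α + 1) * (1 - r ^ 2) ^ α) *
          ∫⁻ θ in Ioo (-π) π, G (circleMap 0 r θ) := by
  rw [lintegral_weightedArea, ← lintegral_indicator measurableSet_ball,
    ← Complex.lintegral_comp_polarCoord_symm]
  congr 1
  have hcirc : ∀ p : ℝ × ℝ, Complex.polarCoord.symm p = circleMap 0 p.1 p.2 := fun p => by
    simp [Complex.polarCoord_symm_apply, circleMap, Complex.exp_mul_I]
  have hmeas : Measurable fun p : ℝ × ℝ => ENNReal.ofReal p.1 *
      ENNReal.ofReal ((α + 1) * (1 - p.1 ^ 2) ^ α) * G (circleMap 0 p.1 p.2) := by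
    have : Continuous fun p : ℝ × ℝ => circleMap 0 p.1 p.2 := circleMap.continuous
    fun_prop
  calc ∫⁻ p in polarCoord.target, ENNReal.ofReal p.1 • (ball (0 : ℂ) 1).indicator
          (fun z => ENNReal.ofReal ((α + 1) * (1 - ‖z‖ ^ 2) ^ α) * G z) (Complex.polarCoord.symm p)
      = ∫⁻ p in polarCoord.target, (Ioo (0 : ℝ) 1 ×ˢ Ioo (-π) π).indicator (fun p : ℝ × ℝ =>
          ENNReal.ofReal p.1 * ENNReal.ofReal ((α + 1) * (1 - p.1 ^ 2) ^ α) *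
            G (circleMap 0 p.1 p.2)) p := by
        refine setLIntegral_congr_fun polarCoord.open_target.measurableSet fun p hp => ?_
        obtain ⟨h0, hθ⟩ := hp
        have h0' : 0 < p.1 := h0
        have hn : ‖circleMap 0 p.1 p.2‖ = p.1 := by simp [abs_of_pos h0']
        simp only [hcirc, smul_eq_mul]
        by_cases h1 : p.1 < 1
        · rw [indicator_of_mem (by simpa [abs_of_pos h0'] using h1),
            indicator_of_mem (by exact ⟨⟨h0', h1⟩, hθ⟩), hn, mul_assoc]
        · rw [indicator_of_notMem (by simpa [abs_of_pos h0'] using h1),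
            indicator_of_notMem (fun h => h1 h.1.2), mul_zero]
    _ = ∫⁻ p in Ioo (0 : ℝ) 1 ×ˢ Ioo (-π) π,
          ENNReal.ofReal p.1 * ENNReal.ofReal ((α + 1) * (1 - p.1 ^ 2) ^ α) *
            G (circleMap 0 p.1 p.2) := by
        rw [setLIntegral_indicator (measurableSet_Ioo.prod measurableSet_Ioo),
          inter_eq_left.2]
        rintro p ⟨h1, h2⟩
        exact ⟨h1.1, h2⟩
    _ = _ := by
        rw [Measure.volume_eq_prod, ← Measure.prod_restrict, lintegral_prod _ hmeas.aemeasurable]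
        refine lintegral_congr fun r => ?_
        simp only
        rw [lintegral_const_mul' _ _ (by finiteness)]

/-- The radial density is, up to a constant, the nonnegative derivative of $-(1-r^2)^{\alpha+1}$,
which is continuous up to $r=1$ because $\alpha+1>0$; this covers the densities unbounded at the
boundary. -/
theorem isFiniteMeasure_weightedArea {α : ℝ} (hα : -1 < α) : IsFiniteMeasure (weightedArea α) := by
  have hint : IntegrableOn (fun r : ℝ => 2 * (α + 1) * (r * (1 - r ^ 2) ^ α)) (Ioc 0 1) := by
    refine intervalIntegral.integrableOn_deriv_of_nonneg
      (g := fun r : ℝ => -(1 - r ^ 2) ^ (α + 1)) ?_ ?_ ?_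
    · refine (ContinuousOn.rpow_const (by fun_prop) fun r hr => Or.inr (by linarith)).neg
    · intro r hr
      have h1 : 0 < 1 - r ^ 2 := by nlinarith [hr.1, hr.2]
      have h2 : HasDerivAt (fun r : ℝ => 1 - r ^ 2) (-(2 * r)) r := by
        simpa using (hasDerivAt_pow 2 r).const_sub 1
      refine (h2.rpow_const (p := α + 1) (Or.inl h1.ne')).neg.congr_deriv ?_
      rw [add_sub_cancel_right]
      ring
    · intro r hr
      have h1 : 0 < 1 - r ^ 2 := by nlinarith [hr.1, hr.2]
      have h2 : 0 < α + 1 := by linarith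
      have h3 := hr.1
      positivity
  refine ⟨?_⟩
  rw [← lintegral_one]
  have := lintegral_weightedArea_polar α (measurable_const (a := (1 : ℝ≥0∞)))
  rw [this]
  have hle : ∫⁻ r in Ioo (0 : ℝ) 1, ENNReal.ofReal r * ENNReal.ofReal ((α + 1) * (1 - r ^ 2) ^ α) *
      ∫⁻ _ in Ioo (-π) π, 1 ≤ ENNReal.ofReal (2 * π) *
        ∫⁻ r in Ioc (0 : ℝ) 1, ‖2 * (α + 1) * (r * (1 - r ^ 2) ^ α)‖ₑ := by
    rw [← lintegral_const_mul' _ _ ENNReal.ofReal_ne_top]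
    refine (setLIntegral_mono' measurableSet_Ioo fun r hr => ?_).trans
      (lintegral_mono_set Ioo_subset_Ioc_self)
    have h1 : 0 < 1 - r ^ 2 := by nlinarith [hr.1, hr.2]
    have h2 : 0 < α + 1 := by linarith
    have h3 := hr.1
    rw [setLIntegral_one, Real.volume_Ioo, sub_neg_eq_add, ← two_mul, mul_comm,
      ← ENNReal.ofReal_mul h3.le, Real.enorm_eq_ofReal (by positivity)]
    gcongr ENNReal.ofReal (2 * π) * ENNReal.ofReal ?_
    have : 0 < (α + 1) * (r * (1 - r ^ 2) ^ α) := by positivity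
    linarith
  refine ENNReal.mul_lt_top ENNReal.ofReal_lt_top (hle.trans_lt ?_)
  exact ENNReal.mul_lt_top ENNReal.ofReal_lt_top hint.hasFiniteIntegral

variable {X : Type*} [NormedAddCommGroup X]

theorem lintegral_enorm_sq_circleMap {F : ℂ → X} (hF : ContinuousOn F (ball 0 1)) {r : ℝ}
    (hr0 : 0 < r) (hr : r < 1) :
    ∫⁻ θ in Ioo (-π) π, ‖F (circleMap 0 r θ)‖ₑ ^ 2 =
      ENNReal.ofReal (2 * π * circleAverage (fun z => ‖F z‖ ^ 2) 0 r) := by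
  have hcont : Continuous fun θ => ‖F (circleMap 0 r θ)‖ ^ 2 := by
    refine (Continuous.norm ?_).pow 2
    refine hF.comp_continuous (continuous_circleMap 0 r) fun θ => ?_
    simp [abs_of_pos hr0, hr]
  have h1 : 2 * π * circleAverage (fun z => ‖F z‖ ^ 2) 0 r =
      ∫ θ in Ioo (-π) π, ‖F (circleMap 0 r θ)‖ ^ 2 := by
    -- `circleAverage` integrates over $(0,2\pi)$, polar coordinates over $(-\pi,\pi)$.
    have hper : (fun θ => ‖F (circleMap 0 r θ)‖ ^ 2).Periodic (2 * π) := fun θ => by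
      simp [periodic_circleMap 0 r θ]
    have := hper.intervalIntegral_add_eq 0 (-π)
    rw [zero_add, show -π + 2 * π = π by ring] at this
    rw [circleAverage, smul_eq_mul, mul_inv_cancel_left₀ (by positivity), this,
      intervalIntegral.integral_of_le (by linarith [pi_pos]), integral_Ioc_eq_integral_Ioo]
  rw [h1, ofReal_integral_eq_lintegral_ofReal
    ((hcont.integrableOn_Icc (a := -π) (b := π)).mono_set Ioo_subset_Icc_self)
    (Filter.Eventually.of_forall fun θ => by positivity)]
  refine lintegral_congr fun θ => ?_
  rw [ENNReal.ofReal_pow (norm_nonneg _), ofReal_norm]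

/-- Comparison of weighted area integrals from comparison of circle means. -/
theorem lintegral_enorm_sq_weightedArea_mono (α : ℝ) {F G : ℂ → X}
    (hF : ContinuousOn F (ball 0 1)) (hG : ContinuousOn G (ball 0 1))
    (h : ∀ r : ℝ, 0 < r → r < 1 →
      circleAverage (fun z => ‖F z‖ ^ 2) 0 r ≤ circleAverage (fun z => ‖G z‖ ^ 2) 0 r) :
    ∫⁻ z : OpenUnitDisk, ‖F z‖ₑ ^ 2 ∂weightedArea α ≤
      ∫⁻ z : OpenUnitDisk, ‖G z‖ₑ ^ 2 ∂weightedArea α := by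
  classical
  have key : ∀ K : ℂ → X, ContinuousOn K (ball 0 1) →
      ∫⁻ z : OpenUnitDisk, ‖K z‖ₑ ^ 2 ∂weightedArea α =
        ENNReal.ofReal π⁻¹ * ∫⁻ r in Ioo (0 : ℝ) 1,
          ENNReal.ofReal r * ENNReal.ofReal ((α + 1) * (1 - r ^ 2) ^ α) *
            ENNReal.ofReal (2 * π * circleAverage (fun z => ‖K z‖ ^ 2) 0 r) := by
    intro K hK
    -- `K` is arbitrary off the disk, so it is cut off to obtain a measurable integrand.
    have hm : Measurable ((ball (0 : ℂ) 1).indicator fun z => ‖K z‖ₑ ^ 2) := by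
      have := ContinuousOn.measurable_piecewise (s := ball (0 : ℂ) 1)
        (f := fun z => ‖K z‖ₑ ^ 2) (g := fun _ => (0 : ℝ≥0∞))
        (by exact (ENNReal.continuous_pow 2).comp_continuousOn hK.enorm) continuousOn_const measurableSet_ball
      rwa [← piecewise_eq_indicator]
    have h1 := lintegral_weightedArea_polar α hm
    have h2 : ∀ z : OpenUnitDisk,
        (ball (0 : ℂ) 1).indicator (fun z => ‖K z‖ₑ ^ 2) z = ‖K z‖ₑ ^ 2 := fun z =>
      indicator_of_mem z.2 _
    simp only [h2] at h1
    rw [h1]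
    congr 1
    refine setLIntegral_congr_fun measurableSet_Ioo fun r hr => ?_
    rw [← lintegral_enorm_sq_circleMap hK hr.1 hr.2]
    congr 1
    refine lintegral_congr fun θ => indicator_of_mem ?_ _
    simp [abs_of_pos hr.1, hr.2]
  rw [key F hF, key G hG]
  gcongr 1
  refine setLIntegral_mono' measurableSet_Ioo fun r hr => ?_
  exact mul_le_mul' le_rfl (ENNReal.ofReal_le_ofReal
    (mul_le_mul_of_nonneg_left (h r hr.1 hr.2) (by positivity)))

end PolarCoordinates

/-! ### Disk automorphisms and the reproducing kernel -/

section DiskAutomorphism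

open Real Metric Set ComplexConjugate
open scoped ENNReal

/-- The involutive automorphism of the disk that exchanges `0` and `a`. -/
noncomputable def diskInvolution (a z : ℂ) : ℂ := (a - z) / (1 - conj a * z)

variable {a z : ℂ}

theorem one_sub_conj_mul_re_pos (ha : ‖a‖ < 1) (hz : ‖z‖ < 1) : 0 < (1 - conj a * z).re := by
  have h1 : (conj a * z).re ≤ ‖a‖ * ‖z‖ := by
    simpa using Complex.re_le_norm (conj a * z)
  have h2 : ‖a‖ * ‖z‖ < 1 := mul_lt_one_of_nonneg_of_lt_one_left (norm_nonneg a) ha hz.le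
  simp only [Complex.sub_re, Complex.one_re]
  linarith

theorem one_sub_conj_mul_ne_zero (ha : ‖a‖ < 1) (hz : ‖z‖ < 1) : 1 - conj a * z ≠ 0 := fun h => by
  simpa [h] using one_sub_conj_mul_re_pos ha hz

theorem one_sub_norm_sq_pos (hz : ‖z‖ < 1) : 0 < 1 - ‖z‖ ^ 2 := by
  nlinarith [norm_nonneg z]

/-- The factor in front of $1-|z|^2$ is $|\varphi_a'(z)|$, so the weight transforms by a power of
the derivative. -/
theorem one_sub_norm_sq_diskInvolution (ha : ‖a‖ < 1) (hz : ‖z‖ < 1) :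
    1 - ‖diskInvolution a z‖ ^ 2 =
      (1 - ‖a‖ ^ 2) / ‖1 - conj a * z‖ ^ 2 * (1 - ‖z‖ ^ 2) := by
  have h := one_sub_conj_mul_ne_zero ha hz
  have h' : ‖1 - conj a * z‖ ^ 2 ≠ 0 := by positivity
  rw [diskInvolution, norm_div, div_pow, div_mul_eq_mul_div, eq_div_iff h', sub_mul,
    div_mul_cancel₀ _ h', one_mul]
  simp only [← Complex.normSq_eq_norm_sq, Complex.normSq_apply]
  simp
  ring

theorem norm_diskInvolution_lt_one (ha : ‖a‖ < 1) (hz : ‖z‖ < 1) : ‖diskInvolution a z‖ < 1 := by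
  have h := one_sub_norm_sq_diskInvolution ha hz
  have h1 := one_sub_norm_sq_pos ha
  have h2 := one_sub_norm_sq_pos hz
  have h3 : 0 < ‖1 - conj a * z‖ := norm_pos_iff.2 (one_sub_conj_mul_ne_zero ha hz)
  have h4 : 0 < 1 - ‖diskInvolution a z‖ ^ 2 := by rw [h]; positivity
  nlinarith [norm_nonneg (diskInvolution a z)]

theorem mapsTo_diskInvolution (ha : ‖a‖ < 1) :
    MapsTo (diskInvolution a) (ball 0 1) (ball 0 1) := fun _ hz =>
  mem_ball_zero_iff.2 (norm_diskInvolution_lt_one ha (mem_ball_zero_iff.1 hz))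

theorem diskInvolution_diskInvolution (ha : ‖a‖ < 1) (hz : ‖z‖ < 1) :
    diskInvolution a (diskInvolution a z) = z := by
  have h1 := one_sub_conj_mul_ne_zero ha hz
  have h2 := one_sub_conj_mul_ne_zero ha (norm_diskInvolution_lt_one ha hz)
  rw [diskInvolution, div_eq_iff h2]
  have h3 : diskInvolution a z * (1 - conj a * z) = a - z := div_mul_cancel₀ _ h1
  refine mul_right_cancel₀ h1 ?_
  linear_combination (z * conj a - 1) * h3

theorem hasDerivAt_diskInvolution (ha : ‖a‖ < 1) (hz : ‖z‖ < 1) :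
    HasDerivAt (diskInvolution a) (-(1 - (‖a‖ : ℂ) ^ 2) / (1 - conj a * z) ^ 2) z := by
  have h1 := one_sub_conj_mul_ne_zero ha hz
  have h2 : HasDerivAt (fun w => a - w) (-1) z := by simpa using (hasDerivAt_id z).const_sub a
  have h3 : HasDerivAt (fun w => 1 - conj a * w) (-conj a) z := by
    simpa using ((hasDerivAt_id z).const_mul (conj a)).const_sub 1
  refine (h2.div h3 h1).congr_deriv ?_
  congr 1
  rw [← Complex.mul_conj']
  ring

theorem differentiableOn_diskInvolution (ha : ‖a‖ < 1) :
    DifferentiableOn ℂ (diskInvolution a) (ball 0 1) := fun _ hz =>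
  (hasDerivAt_diskInvolution ha
    (mem_ball_zero_iff.1 hz)).differentiableAt.differentiableWithinAt

/-- The real determinant of multiplication by $w$ on `ℂ` is $|w|^2$. -/
theorem Complex.lintegral_image_eq_lintegral_norm_deriv_sq_mul {s : Set ℂ} (hs : MeasurableSet s)
    {f f' : ℂ → ℂ} (hf' : ∀ x ∈ s, HasDerivAt f (f' x) x) (hf : InjOn f s) (g : ℂ → ℝ≥0∞) :
    ∫⁻ x in f '' s, g x = ∫⁻ x in s, ENNReal.ofReal (‖f' x‖ ^ 2) * g (f x) := by
  rw [lintegral_image_eq_lintegral_abs_det_fderiv_mul volume hs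
    (fun x hx => ((hf' x hx).hasFDerivAt.restrictScalars ℝ).hasFDerivWithinAt) hf]
  refine lintegral_congr fun x => ?_
  congr 2
  simp [ContinuousLinearMap.det, LinearMap.det_restrictScalars, Algebra.norm_complex_eq,
    Complex.normSq_eq_norm_sq]

/-- Change of variables by a disk automorphism in the weighted area integral. -/
theorem lintegral_weightedArea_eq_diskInvolution (α : ℝ) (ha : ‖a‖ < 1) (G : ℂ → ℝ≥0∞) :
    ∫⁻ z : OpenUnitDisk, G z ∂weightedArea α =
      ∫⁻ z : OpenUnitDisk,
        ENNReal.ofReal (((1 - ‖a‖ ^ 2) / ‖1 - conj a * (z : ℂ)‖ ^ 2) ^ (α + 2)) *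
          G (diskInvolution a z) ∂weightedArea α := by
  rw [lintegral_weightedArea, lintegral_weightedArea α fun z =>
    ENNReal.ofReal (((1 - ‖a‖ ^ 2) / ‖1 - conj a * z‖ ^ 2) ^ (α + 2)) * G (diskInvolution a z)]
  congr 1
  have himage : diskInvolution a '' ball 0 1 = ball 0 1 := by
    refine (mapsTo_diskInvolution ha).image_subset.antisymm fun z hz => ?_
    exact ⟨_, mapsTo_diskInvolution ha hz,
      diskInvolution_diskInvolution ha (mem_ball_zero_iff.1 hz)⟩
  have hinj : InjOn (diskInvolution a) (ball 0 1) := fun z hz w hw h => by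
    rw [← diskInvolution_diskInvolution ha (mem_ball_zero_iff.1 hz), h,
      diskInvolution_diskInvolution ha (mem_ball_zero_iff.1 hw)]
  nth_rw 1 [← himage]
  rw [Complex.lintegral_image_eq_lintegral_norm_deriv_sq_mul measurableSet_ball
    (fun z hz => hasDerivAt_diskInvolution ha (mem_ball_zero_iff.1 hz)) hinj]
  refine setLIntegral_congr_fun measurableSet_ball fun z hz => ?_
  have hz' := mem_ball_zero_iff.1 hz
  simp only [← mul_assoc]
  congr 1
  have h1 := one_sub_norm_sq_pos ha
  have h2 := one_sub_norm_sq_pos hz'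
  have h3 : 0 < ‖1 - conj a * z‖ := norm_pos_iff.2 (one_sub_conj_mul_ne_zero ha hz')
  -- $J=|\varphi_a'(z)|$: the real Jacobian contributes $J^2$ and the weight $J^\alpha$, whence the
  -- exponent $\alpha+2$.
  set J := (1 - ‖a‖ ^ 2) / ‖1 - conj a * z‖ ^ 2 with hJ
  have hJ0 : 0 < J := by positivity
  have hn : ‖-(1 - (‖a‖ : ℂ) ^ 2) / (1 - conj a * z) ^ 2‖ = J := by
    rw [norm_div, norm_neg, norm_pow, hJ]
    congr 1
    rw [← Complex.ofReal_pow, ← Complex.ofReal_one, ← Complex.ofReal_sub, Complex.norm_real,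
      Real.norm_of_nonneg h1.le]
  rw [hn, one_sub_norm_sq_diskInvolution ha hz', ← hJ, ← ENNReal.ofReal_mul (by positivity),
    ← ENNReal.ofReal_mul' (by positivity), mul_rpow hJ0.le h2.le, rpow_add hJ0, rpow_two]
  congr 1
  ring

variable {X : Type*} [NormedAddCommGroup X]

/-- The change of variables undoes the involution, and $|1-\bar az|\ge1-|a|$ bounds its density. -/
theorem lintegral_enorm_sq_comp_diskInvolution_le {α : ℝ} (hα : -1 < α) (ha : ‖a‖ < 1)
    (F : ℂ → X) :
    ∫⁻ z : OpenUnitDisk, ‖F (diskInvolution a z)‖ₑ ^ 2 ∂weightedArea α ≤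
      ENNReal.ofReal (((1 - ‖a‖ ^ 2) / (1 - ‖a‖) ^ 2) ^ (α + 2)) *
        ∫⁻ z : OpenUnitDisk, ‖F z‖ₑ ^ 2 ∂weightedArea α := by
  rw [lintegral_weightedArea_eq_diskInvolution α ha fun z => ‖F (diskInvolution a z)‖ₑ ^ 2,
    ← lintegral_const_mul' _ _ ENNReal.ofReal_ne_top]
  refine lintegral_mono fun z => ?_
  simp only
  rw [diskInvolution_diskInvolution ha z.norm_lt_one]
  have h0 := one_sub_norm_sq_pos ha
  have h1 : ‖conj a * (z : ℂ)‖ ≤ ‖a‖ := by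
    rw [norm_mul, RCLike.norm_conj]
    exact mul_le_of_le_one_right (norm_nonneg a) z.norm_lt_one.le
  have h2 := norm_sub_norm_le (1 : ℂ) (conj a * (z : ℂ))
  rw [norm_one] at h2
  have h3 : 0 < 1 - ‖a‖ := by linarith
  have h4 : (1 - ‖a‖) ^ 2 ≤ ‖1 - conj a * (z : ℂ)‖ ^ 2 := by
    gcongr
    linarith
  exact mul_le_mul' (ENNReal.ofReal_le_ofReal (rpow_le_rpow (by positivity)
    (div_le_div_of_nonneg_left h0.le (by positivity) h4) (by linarith))) le_rfl

/-- The reproducing kernel of the weighted Bergman space at `a`. -/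
noncomputable def bergmanKernel (α : ℝ) (a z : ℂ) : ℂ :=
  Complex.exp (-((α + 2 : ℝ) * Complex.log (1 - conj a * z)))

theorem differentiableOn_bergmanKernel (α : ℝ) (ha : ‖a‖ < 1) :
    DifferentiableOn ℂ (bergmanKernel α a) (ball 0 1) := by
  -- Positive real part keeps the principal logarithm off its cut, so the real power is holomorphic.
  have h : ∀ z ∈ ball (0 : ℂ) 1, 1 - conj a * z ∈ Complex.slitPlane := fun z hz =>
    Or.inl (one_sub_conj_mul_re_pos ha (mem_ball_zero_iff.1 hz))
  unfold bergmanKernel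
  exact (((DifferentiableOn.clog (by fun_prop) h).const_mul _).neg).cexp

theorem norm_bergmanKernel (α : ℝ) (ha : ‖a‖ < 1) (hz : ‖z‖ < 1) :
    ‖bergmanKernel α a z‖ = (‖1 - conj a * z‖ ^ (α + 2))⁻¹ := by
  have h3 : 0 < ‖1 - conj a * z‖ := norm_pos_iff.2 (one_sub_conj_mul_ne_zero ha hz)
  rw [bergmanKernel, Complex.norm_exp, Complex.neg_re, Complex.re_ofReal_mul, Complex.log_re,
    Real.exp_neg, rpow_def_of_pos h3, mul_comm]

theorem norm_bergmanKernel_self (α : ℝ) (ha : ‖a‖ < 1) :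
    ‖bergmanKernel α a a‖ = ((1 - ‖a‖ ^ 2) ^ (α + 2))⁻¹ := by
  rw [norm_bergmanKernel α ha ha, Complex.conj_mul', ← Complex.ofReal_pow, ← Complex.ofReal_one,
    ← Complex.ofReal_sub, Complex.norm_real, Real.norm_of_nonneg (one_sub_norm_sq_pos ha).le]

/-- $(1-|a|^2)^{\alpha+2}|k_a|^2$ is exactly the density in the change of variables, applied here to
the constant $1$. -/
theorem lintegral_enorm_sq_bergmanKernel (α : ℝ) (ha : ‖a‖ < 1) :
    ENNReal.ofReal ((1 - ‖a‖ ^ 2) ^ (α + 2)) *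
      ∫⁻ z : OpenUnitDisk, ‖bergmanKernel α a z‖ₑ ^ 2 ∂weightedArea α =
        weightedArea α Set.univ := by
  rw [← lintegral_one, lintegral_weightedArea_eq_diskInvolution α ha fun _ => 1,
    ← lintegral_const_mul' _ _ ENNReal.ofReal_ne_top]
  refine lintegral_congr fun z => ?_
  have h1 := one_sub_norm_sq_pos ha
  have h3 : 0 < ‖1 - conj a * (z : ℂ)‖ :=
    norm_pos_iff.2 (one_sub_conj_mul_ne_zero ha z.norm_lt_one)
  have h4 : (‖1 - conj a * (z : ℂ)‖ ^ (α + 2)) ^ 2 = (‖1 - conj a * (z : ℂ)‖ ^ 2) ^ (α + 2) := by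
    rw [← rpow_mul_natCast h3.le, ← rpow_natCast_mul h3.le, mul_comm (α + 2)]
  rw [mul_one, ← ofReal_norm, norm_bergmanKernel α ha z.norm_lt_one,
    ← ENNReal.ofReal_pow (by positivity), ← ENNReal.ofReal_mul (by positivity),
    div_rpow h1.le (by positivity), inv_pow, ← div_eq_mul_inv, h4]

end DiskAutomorphism

/-! ### Composition in the weighted quadratic mean -/

section Composition

open Real Metric Set ComplexConjugate
open scoped ENNReal

variable {X : Type*} [NormedAddCommGroup X] [InnerProductSpace ℂ X] [CompleteSpace X]

theorem lintegral_enorm_sq_comp_le_of_map_zero (α : ℝ) {F : ℂ → X}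
    (hF : DifferentiableOn ℂ F (ball 0 1)) {ψ : ℂ → ℂ} (hψ : DifferentiableOn ℂ ψ (ball 0 1))
    (hmaps : MapsTo ψ (ball 0 1) (ball 0 1)) (hψ0 : ψ 0 = 0) :
    ∫⁻ z : OpenUnitDisk, ‖F (ψ z)‖ₑ ^ 2 ∂weightedArea α ≤
      ∫⁻ z : OpenUnitDisk, ‖F z‖ₑ ^ 2 ∂weightedArea α :=
  lintegral_enorm_sq_weightedArea_mono α (F := fun z => F (ψ z)) (hF.comp hψ hmaps).continuousOn
    hF.continuousOn fun _ hr0 hr => circleAverage_norm_sq_comp_le hF hψ hmaps hψ0 hr0 hr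

/-- Subordination to the zero map. -/
theorem enorm_sq_apply_zero_mul_le (α : ℝ) {F : ℂ → X} (hF : DifferentiableOn ℂ F (ball 0 1)) :
    ‖F 0‖ₑ ^ 2 * weightedArea α Set.univ ≤
      ∫⁻ z : OpenUnitDisk, ‖F z‖ₑ ^ 2 ∂weightedArea α := by
  have := lintegral_enorm_sq_comp_le_of_map_zero α hF (ψ := fun _ => 0)
    (differentiableOn_const 0) (fun _ _ => mem_ball_self one_pos) rfl
  simpa using this

/-- Composition with a holomorphic self-map of the disk is bounded in the weighted quadratic
mean. -/
theorem lintegral_enorm_sq_comp_le {α : ℝ} (hα : -1 < α) {F : ℂ → X}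
    (hF : DifferentiableOn ℂ F (ball 0 1)) {ψ : ℂ → ℂ} (hψ : DifferentiableOn ℂ ψ (ball 0 1))
    (hmaps : MapsTo ψ (ball 0 1) (ball 0 1)) :
    ∫⁻ z : OpenUnitDisk, ‖F (ψ z)‖ₑ ^ 2 ∂weightedArea α ≤
      ENNReal.ofReal (((1 - ‖ψ 0‖ ^ 2) / (1 - ‖ψ 0‖) ^ 2) ^ (α + 2)) *
        ∫⁻ z : OpenUnitDisk, ‖F z‖ₑ ^ 2 ∂weightedArea α := by
  have ha : ‖ψ 0‖ < 1 := mem_ball_zero_iff.1 (hmaps (mem_ball_self one_pos))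
  have hd := differentiableOn_diskInvolution ha
  have hm := mapsTo_diskInvolution ha
  calc ∫⁻ z : OpenUnitDisk, ‖F (ψ z)‖ₑ ^ 2 ∂weightedArea α
      = ∫⁻ z : OpenUnitDisk,
          ‖F (diskInvolution (ψ 0) (diskInvolution (ψ 0) (ψ z)))‖ₑ ^ 2 ∂weightedArea α := by
        refine lintegral_congr fun z => ?_
        rw [diskInvolution_diskInvolution ha (mem_ball_zero_iff.1 (hmaps z.2))]
    _ ≤ ∫⁻ z : OpenUnitDisk, ‖F (diskInvolution (ψ 0) z)‖ₑ ^ 2 ∂weightedArea α :=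
        lintegral_enorm_sq_comp_le_of_map_zero α (F := fun z => F (diskInvolution (ψ 0) z))
          (ψ := fun z => diskInvolution (ψ 0) (ψ z)) (hF.comp hd hm) (hd.comp hψ hmaps)
          (hm.comp hmaps) (by simp [diskInvolution])
    _ ≤ _ := lintegral_enorm_sq_comp_diskInvolution_le hα ha F

end Composition

/-! ### The Bergman norm as a lower Lebesgue integral -/

section BergmanNorm

open scoped ENNReal

variable {α : ℝ} {hα : -1 < α} {H : Type*} [NormedAddCommGroup H] [NormedSpace ℂ H]
  [CompleteSpace H]

theorem eLpNorm_two_sq_eq_lintegral {Ω : Type*} [MeasurableSpace Ω] {E : Type*}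
    [NormedAddCommGroup E] (μ : Measure Ω) (f : Ω → E) :
    eLpNorm f 2 μ ^ 2 = ∫⁻ z, ‖f z‖ₑ ^ 2 ∂μ := by
  rw [eLpNorm_eq_lintegral_rpow_enorm_toReal (by norm_num) (by norm_num), ← ENNReal.rpow_natCast,
    ← ENNReal.rpow_mul]
  simp

theorem OpenUnitDisk.IsAnalytic.memLp_two_iff {f : OpenUnitDisk → H} (hf : IsAnalytic f) :
    MemLp f 2 (weightedArea α) ↔ ∫⁻ z, ‖f z‖ₑ ^ 2 ∂weightedArea α < ∞ := by
  rw [← eLpNorm_two_sq_eq_lintegral, ENNReal.pow_lt_top_iff]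
  have h : AEStronglyMeasurable f (weightedArea α) := hf.continuous.aestronglyMeasurable
  simp [MemLp, h]

theorem BergmanSpace.enorm_sq_eq (f : BergmanSpace α hα H) :
    ENNReal.ofReal (‖f‖ ^ 2) = ∫⁻ z, ‖f z‖ₑ ^ 2 ∂weightedArea α := by
  have h1 : ‖f‖ = (eLpNorm (f : OpenUnitDisk → H) 2 (weightedArea α)).toReal :=
    Lp.norm_toLp _ f.memLp
  rw [h1, ENNReal.ofReal_pow ENNReal.toReal_nonneg, ENNReal.ofReal_toReal f.memLp.eLpNorm_ne_top,
    eLpNorm_two_sq_eq_lintegral]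

end BergmanNorm

/-! ### The composition operator and its norm -/

open Metric in
theorem mainTheorem8 {H : Type*} [NormedAddCommGroup H] [InnerProductSpace ℂ H]
    [CompleteSpace H] [TopologicalSpace.SeparableSpace H] [Nontrivial H]
    (α : ℝ) (hα : -1 < α) (Φ : OpenUnitDisk → OpenUnitDisk)
    (hΦ : OpenUnitDisk.IsAnalytic fun z => (Φ z : ℂ)) :
    ∃ C : BergmanSpace α hα H →L[ℂ] BergmanSpace α hα H,
      (∀ (f : BergmanSpace α hα H) (z : OpenUnitDisk), C f z = f (Φ z)) ∧
      1 / √((1 - ‖(Φ OpenUnitDisk.origin : ℂ)‖ ^ 2) ^ (2 + α)) ≤ ‖C‖ := by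
  obtain ⟨ψ, hψ, hψΦ⟩ := hΦ.exists_differentiableOn
  have hmaps : Set.MapsTo ψ (ball 0 1) (ball 0 1) := fun z hz => by
    have := (Φ ⟨z, hz⟩).2
    rwa [← hψΦ] at this
  have hψ0 : ψ 0 = Φ origin := hψΦ origin
  have ha : ‖ψ 0‖ < 1 := mem_ball_zero_iff.1 (hmaps (mem_ball_self one_pos))
  rw [← hψ0]
  set K : ℝ := ((1 - ‖ψ 0‖ ^ 2) / (1 - ‖ψ 0‖) ^ 2) ^ (α + 2) with hK
  have hp := one_sub_norm_sq_pos ha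
  have hK0 : 0 ≤ K := by positivity
  have hcomp : ∀ f : BergmanSpace α hα H, IsAnalytic (fun z => f (Φ z)) ∧
      ∫⁻ z, ‖f (Φ z)‖ₑ ^ 2 ∂weightedArea α ≤
        ENNReal.ofReal K * ∫⁻ z, ‖f z‖ₑ ^ 2 ∂weightedArea α := by
    intro f
    obtain ⟨F, hF, hFf⟩ := f.isAnalytic.exists_differentiableOn
    have h1 : ∀ z : OpenUnitDisk, F (ψ z) = f (Φ z) := fun z => by rw [hψΦ, hFf]
    have h2 := isAnalytic_of_differentiableOn (hF.comp hψ hmaps)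
    have h3 := lintegral_enorm_sq_comp_le hα hF hψ hmaps
    simp only [Function.comp_apply, h1] at h2
    simp only [h1, hFf] at h3
    exact ⟨h2, h3⟩
  have hmem : ∀ f : BergmanSpace α hα H, (fun z => f (Φ z)) ∈ bergmanSubmodule α H := fun f =>
    ⟨(hcomp f).1, (hcomp f).1.memLp_two_iff.2 ((hcomp f).2.trans_lt
      (ENNReal.mul_lt_top ENNReal.ofReal_lt_top (f.isAnalytic.memLp_two_iff.1 f.memLp)))⟩
  let L : BergmanSpace α hα H →ₗ[ℂ] BergmanSpace α hα H :=
    { toFun := fun f => (⟨_, hmem f⟩ : ↥(bergmanSubmodule α H))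
      map_add' := fun _ _ => rfl
      map_smul' := fun _ _ => rfl }
  have hL : ∀ f z, L f z = f (Φ z) := fun _ _ => rfl
  have hLb : ∀ f, ‖L f‖ ≤ √K * ‖f‖ := by
    intro f
    have h1 : ENNReal.ofReal (‖L f‖ ^ 2) ≤ ENNReal.ofReal (K * ‖f‖ ^ 2) := by
      rw [ENNReal.ofReal_mul hK0, BergmanSpace.enorm_sq_eq, BergmanSpace.enorm_sq_eq]
      exact (hcomp f).2
    rw [ENNReal.ofReal_le_ofReal_iff (by positivity)] at h1
    rw [← Real.sqrt_sq (norm_nonneg f), ← Real.sqrt_mul hK0]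
    exact Real.le_sqrt_of_sq_le h1
  refine ⟨L.mkContinuous (√K) hLb, fun f z => hL f z, ?_⟩
  set C := L.mkContinuous (√K) hLb with hC
  -- test the operator on the reproducing kernel at `ψ 0`
  obtain ⟨h, hh⟩ := exists_ne (0 : H)
  have hh0 : 0 < ‖h‖ := norm_pos_iff.2 hh
  have := isFiniteMeasure_weightedArea hα
  have := isOpenPosMeasure_weightedArea hα
  have : Nonempty OpenUnitDisk := ⟨origin⟩
  -- Only $0<m<\infty$ is needed, since $m$ cancels from the final quotient.
  set m := (weightedArea α).real Set.univ with hm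
  have hm0 : 0 < m := ENNReal.toReal_pos (isOpen_univ.measure_ne_zero _ Set.univ_nonempty)
    (measure_ne_top _ _)
  have hmE : weightedArea α Set.univ = ENNReal.ofReal m := (ofReal_measureReal).symm
  set p : ℝ := (1 - ‖ψ 0‖ ^ 2) ^ (α + 2) with hpdef
  have hp0 : 0 < p := by positivity
  set k : ℂ → H := fun z => bergmanKernel α (ψ 0) z • h with hk
  have hkd : DifferentiableOn ℂ k (ball 0 1) :=
    (differentiableOn_bergmanKernel α ha).smul_const h
  have hkan := isAnalytic_of_differentiableOn hkd
  have hkE : ∫⁻ z : OpenUnitDisk, ‖k z‖ₑ ^ 2 ∂weightedArea α =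
      ENNReal.ofReal (p⁻¹ * m * ‖h‖ ^ 2) := by
    have h1 : ∫⁻ z : OpenUnitDisk, ‖k z‖ₑ ^ 2 ∂weightedArea α =
        (∫⁻ z : OpenUnitDisk, ‖bergmanKernel α (ψ 0) z‖ₑ ^ 2 ∂weightedArea α) *
          ENNReal.ofReal (‖h‖ ^ 2) := by
      rw [← lintegral_mul_const' _ _ ENNReal.ofReal_ne_top]
      refine lintegral_congr fun z => ?_
      rw [hk, enorm_smul, mul_pow, ENNReal.ofReal_pow (norm_nonneg h), ofReal_norm]
    have h2 := lintegral_enorm_sq_bergmanKernel α ha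
    rw [h1, ENNReal.ofReal_mul (by positivity), ENNReal.ofReal_mul (by positivity), ← hmE, ← h2,
      ← mul_assoc, ← ENNReal.ofReal_mul (by positivity), inv_mul_cancel₀ hp0.ne',
      ENNReal.ofReal_one, one_mul]
  let f : BergmanSpace α hα H :=
    (⟨fun z => k z, hkan, hkan.memLp_two_iff.2 (hkE ▸ ENNReal.ofReal_lt_top)⟩ :
      ↥(bergmanSubmodule α H))
  have hf : ‖f‖ ^ 2 = p⁻¹ * m * ‖h‖ ^ 2 := by
    rw [← ENNReal.ofReal_eq_ofReal_iff (by positivity) (by positivity), BergmanSpace.enorm_sq_eq]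
    exact hkE
  -- Evaluation at the origin, where $Cf$ takes the value $k(\psi(0))$.
  have hCf : (p⁻¹ * ‖h‖) ^ 2 * m ≤ ‖C f‖ ^ 2 := by
    rw [← ENNReal.ofReal_le_ofReal_iff (by positivity), BergmanSpace.enorm_sq_eq]
    have h1 := enorm_sq_apply_zero_mul_le α (F := fun z => k (ψ z)) (hkd.comp hψ hmaps)
    have h2 : ‖k (ψ 0)‖ = p⁻¹ * ‖h‖ := by
      rw [hk, norm_smul, norm_bergmanKernel_self α ha]
    have h3 : ∀ z : OpenUnitDisk, k (ψ z) = C f z := fun z => by rw [hψΦ]; rfl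
    rw [← ofReal_norm, h2, hmE, ← ENNReal.ofReal_pow (by positivity),
      ← ENNReal.ofReal_mul (by positivity)] at h1
    simpa only [h3] using h1
  have hop : ‖C f‖ ^ 2 ≤ ‖C‖ ^ 2 * ‖f‖ ^ 2 := by
    rw [← mul_pow]
    gcongr
    exact C.le_opNorm f
  rw [hf] at hop
  have hfin : p⁻¹ ≤ ‖C‖ ^ 2 := by
    have h1 : p⁻¹ * (p⁻¹ * m * ‖h‖ ^ 2) ≤ ‖C‖ ^ 2 * (p⁻¹ * m * ‖h‖ ^ 2) := by
      refine le_trans (le_of_eq ?_) (hCf.trans hop)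
      ring
    exact le_of_mul_le_mul_right h1 (by positivity)
  rw [add_comm 2 α, ← hpdef, one_div, ← Real.sqrt_inv]
  exact Real.sqrt_le_iff.2 ⟨norm_nonneg C, hfin⟩
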